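/- Let $k\ge 1$ and $n_1,\dots,n_k\ge 1$ be integers, let $\mathbb F_{n_i}^+$ be the unital free semigroup on generators $g_1^i,\dots,g_{n_i}^i$, and let $\mathcal F:=F^2(H_{n_1})\otimes\cdots\otimes F^2(H_{n_k})$ be the Hilbert space tensor product of the full Fock spaces over $\mathbb C^{n_i}$, with its orthonormal basis $e_\beta:=e^1_{\beta_1}\otimes\cdots\otimes e^k_{\beta_k}$, $\beta=(\beta_1,\dots,\beta_k)\in\mathbb F_{n_1}^+\times\cdots\times\mathbb F_{n_k}^+$. For $1\le i\le k$ and $1\le j\le n_i$ let $\mathbf S_{i,j}$ and $\mathbf R_{i,j}$ be the isometries of $\mathcal F$ which replace the $i$-th word $\beta_i$ of a basis vector $e_\beta$ by $g^i_j\beta_i$ and by $\beta_ig^i_j$, respectively; for a word $\alpha=g^i_{j_1}\cdots g^i_{j_p}$ put $\mathbf R_{i,\alpha}:=\mathbf R_{i,j_1}\cdots\mathbf R_{i,j_p}$ and $\widetilde\alpha:=g^i_{j_p}\cdots g^i_{j_1}$. For $\varphi=\sum_\beta c_\beta e_\beta\in\mathcal F$ and a polynomial $p$ (a finite linear combination of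 basis vectors) put $\widetilde\varphi(\mathbf R)p:=\sum_\beta c_\beta\mathbf R_{1,\widetilde\beta_1}\cdots\mathbf R_{k,\widetilde\beta_k}p\in\mathcal F$. The vector $\varphi$ is a right multiplier of $\mathcal F$ if $\sup\{\|\widetilde\varphi(\mathbf R)p\|: p \text{ a polynomial},\ \|p\|\le 1\}<\infty$; then $\widetilde\varphi(\mathbf R)$ denotes also the unique bounded operator on $\mathcal F$ that extends this map. For a closed subspace $M\subseteq\mathcal F$ with orthogonal projection $P_M$, the defect operator is $\Delta_M:=(\mathrm{id}-\Phi_1)\circ\cdots\circ(\mathrm{id}-\Phi_k)(P_M)$, where $\Phi_i(Y):=\sum_{j=1}^{n_i}\mathbf S_{i,j}Y\mathbf S_{i,j}^*$, and $M$ is invariant under $\mathbf S$ if $\mathbf S_{i,j}M\subseteq M$ for all $i,j$. We say that a sequence $\{\psi_s\}_{s=1}^N$, $N\in\{0,1,2,\dots\}\cup\{\infty\}$, of right multipliers of $\mathcal F$ represents $M$ if the operators $\widetilde\psi_s(\mathbf R)$ are isometries with pairwise orthogonal ranges and $$P_M=\sum_{s=1}^N\widetilde\psi_s(\mathbf R)\,\widetilde\psi_s(\mathbf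 R)^*,$$ with convergence in the strong operator topology. (The empty sequence, $N=0$, represents $M=\{0\}$.) **Theorem.** Let $M\subseteq\mathcal F$ be a closed subspace. 1. $M$ is invariant under $\mathbf S$ and $\Delta_M\ge 0$ if and only if some sequence $\{\psi_s\}_{s=1}^N$ of right multipliers of $\mathcal F$ represents $M$. 2. Such a sequence is uniquely determined up to unitary equivalence: if $\{\psi_s\}_{s=1}^N$ and $\{\psi'_s\}_{s=1}^{N'}$ both represent $M$, then $N=N'$ and there is a unitary operator $U:M\to M$ which commutes with every restriction $\mathbf S_{i,j}|_M$ and satisfies $U\psi_s=\psi'_s$ for all $s$. 3. If $M$ is invariant under $\mathbf S$ and $\Delta_M\ge0$, then the sequence $\{\psi_s\}_{s=1}^N$ representing $M$ can be chosen such that each $\psi_s$ is in the range of $\Delta_M$. 4. If $\{\psi_s\}_{s=1}^N$ represents $M$, then $N=\operatorname{rank}(\Delta_M^{1/2})$ and $$\Delta_M\xi=\sum_{s=1}^N\langle\xi,\psi_s\rangle\psi_s,\qquad \xi\in\mathcal F.$$ -/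

import Mathlib

open scoped InnerProductSpace

noncomputable section

namespace Polyball

/-- The index set `𝔽⁺_{n₁} × ⋯ × 𝔽⁺_{n_k}`: the direct product of the unital free semigroups on
`n₁, …, n_k` generators. Multiplication is concatenation in every coordinate. -/
abbrev Words {k : ℕ} (n : Fin k → ℕ) : Type := (i : Fin k) → FreeMonoid (Fin (n i))

instance {k : ℕ} (n : Fin k → ℕ) : DecidableEq (Words n) := Classical.decEq _

/-- The Hilbert space tensor product `F²(H_{n₁}) ⊗ ⋯ ⊗ F²(H_{n_k})` of the full Fock spaces, in
its coordinates with respect to the orthonormal basis `e¹_{β₁} ⊗ ⋯ ⊗ eᵏ_{β_k}`: square summable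
families of complex numbers indexed by `Words n`. -/
abbrev FockTensor {k : ℕ} (n : Fin k → ℕ) : Type := lp (fun _ : Words n => ℂ) 2

/-- The basis vector `e¹_{β₁} ⊗ ⋯ ⊗ eᵏ_{β_k}`. -/
def e {k : ℕ} {n : Fin k → ℕ} (β : Words n) : FockTensor n := lp.single 2 β (1 : ℂ)

theorem orthonormal_e {k : ℕ} {n : Fin k → ℕ} :
    Orthonormal ℂ (e : Words n → FockTensor n) := by
  rw [orthonormal_iff_ite]
  intro β γ
  rw [e, e, lp.inner_single_left, lp.coeFn_single]
  by_cases h : β = γ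
  · subst h; simp
  · simp [h]

theorem hasSum_e {k : ℕ} {n : Fin k → ℕ} (f : FockTensor n) :
    HasSum (fun β => f β • e β) f := by
  have h := lp.hasSum_single (p := 2) (by norm_num) f
  have h2 : (fun β => f β • e β) = fun β => lp.single (E := fun _ : Words n => ℂ) 2 β (f β) := by
    funext β
    rw [e, ← lp.single_smul]
    simp
  rw [h2]
  exact h

/-- The bounded operator (an isometry) sending the basis vector `e β` to `e (σ β)`, for an
injective map `σ` of the index set into itself. -/
def shift {k : ℕ} {n : Fin k → ℕ} (σ : Words n → Words n) (hσ : Function.Injective σ) :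
    FockTensor n →L[ℂ] FockTensor n :=
  ((orthonormal_e.comp σ hσ).orthogonalFamily.linearIsometry).toContinuousLinearMap

theorem shift_e {k : ℕ} {n : Fin k → ℕ} (σ : Words n → Words n) (hσ : Function.Injective σ)
    (β : Words n) : shift σ hσ (e β) = e (σ β) := by
  have h := (orthonormal_e.comp σ hσ).orthogonalFamily.linearIsometry_apply_single
    (i := β) (1 : ℂ)
  exact h.trans (by simp)

/-- The operator `𝐒_{i,j} = I ⊗ ⋯ ⊗ S_{i,j} ⊗ ⋯ ⊗ I` of the universal model: it puts the generator
`g_j` in front of the `i`-th word of a basis vector (`S_{i,j} e_α = e_{g_j α}`). -/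
def S {k : ℕ} (n : Fin k → ℕ) (i : Fin k) (j : Fin (n i)) : FockTensor n →L[ℂ] FockTensor n :=
  shift (fun β => Pi.mulSingle i (FreeMonoid.of j) * β) (mul_right_injective _)

/-- The operator `𝐑_{i,j} = I ⊗ ⋯ ⊗ R_{i,j} ⊗ ⋯ ⊗ I`: it puts the generator `g_j` behind the `i`-th
word of a basis vector (`R_{i,j} e_α = e_{α g_j}`). -/
def R {k : ℕ} (n : Fin k → ℕ) (i : Fin k) (j : Fin (n i)) : FockTensor n →L[ℂ] FockTensor n :=
  shift (fun β => β * Pi.mulSingle i (FreeMonoid.of j)) (mul_left_injective _)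

/-- The completely positive map `Φ_{𝐒_i}(Y) = ∑_j 𝐒_{i,j} Y 𝐒_{i,j}^*`. -/
def Phi {k : ℕ} (n : Fin k → ℕ) (i : Fin k) (Y : FockTensor n →L[ℂ] FockTensor n) :
    FockTensor n →L[ℂ] FockTensor n :=
  ∑ j : Fin (n i), S n i j ∘L Y ∘L ContinuousLinearMap.adjoint (S n i j)

/-- The defect mapping `(id - Φ_{𝐒_1}) ∘ ⋯ ∘ (id - Φ_{𝐒_k})`. -/
def defectMap {k : ℕ} (n : Fin k → ℕ) (Y : FockTensor n →L[ℂ] FockTensor n) :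
    FockTensor n →L[ℂ] FockTensor n :=
  (List.finRange k).foldr (fun i Z => Z - Phi n i Z) Y

/-- The orthogonal projection `P_M` onto the closed subspace `M`, as an operator on the whole
space. -/
def proj {k : ℕ} {n : Fin k → ℕ} (M : ClosedSubmodule ℂ (FockTensor n)) :
    FockTensor n →L[ℂ] FockTensor n :=
  haveI : CompleteSpace M.toSubmodule := M.isClosed.completeSpace_coe
  M.toSubmodule.starProjection

/-- The defect operator `Δ_M` of a closed subspace `M`: the defect mapping applied to `P_M`. -/
def defect {k : ℕ} {n : Fin k → ℕ} (M : ClosedSubmodule ℂ (FockTensor n)) :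
    FockTensor n →L[ℂ] FockTensor n :=
  defectMap n (proj M)

/-- `M` is invariant under the universal model, that is, under every `𝐒_{i,j}`. -/
def IsInvariant {k : ℕ} {n : Fin k → ℕ} (M : ClosedSubmodule ℂ (FockTensor n)) : Prop :=
  ∀ (i : Fin k) (j : Fin (n i)), ∀ f ∈ M, S n i j f ∈ M

/-- The product `𝐑_{1,β̃₁} ⋯ 𝐑_{k,β̃_k}`, where `β̃_i` is the reverse of the word `β_i` and
`𝐑_{i,α} = 𝐑_{i,j₁} ⋯ 𝐑_{i,j_p}` for `α = g_{j₁} ⋯ g_{j_p}`. -/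
def revR {k : ℕ} {n : Fin k → ℕ} (β : Words n) : FockTensor n →L[ℂ] FockTensor n :=
  ((List.finRange k).map fun i => FreeMonoid.lift (R n i) (β i).reverse).prod

theorem lift_R_reverse_e {k : ℕ} {n : Fin k → ℕ} (i : Fin k) (w : FreeMonoid (Fin (n i)))
    (γ : Words n) :
    FreeMonoid.lift (R n i) w.reverse (e γ) = e (γ * Pi.mulSingle i w) := by
  induction w using FreeMonoid.inductionOn' generalizing γ with
  | one => simp [FreeMonoid.reverse]; rfl
  | of_mul j w ih =>
    rw [FreeMonoid.reverse_mul, map_mul, mul_apply_eq_comp, FreeMonoid.reverse_of,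
      FreeMonoid.lift_eval_of, R, shift_e, ih, Pi.mulSingle_mul, mul_assoc]

theorem revR_e {k : ℕ} {n : Fin k → ℕ} (β γ : Words n) : revR β (e γ) = e (γ * β) := by
  have key : ∀ l : List (Fin k), l.Nodup →
      (l.map fun i => FreeMonoid.lift (R n i) (β i).reverse).prod (e γ) =
        e (fun i => if i ∈ l then γ i * β i else γ i) := by
    intro l
    induction l with
    | nil => intro _; simp
    | cons a l ih =>
      intro hl
      rw [List.nodup_cons] at hl
      rw [List.map_cons, List.prod_cons, mul_apply_eq_comp, ih hl.2,
        lift_R_reverse_e]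
      congr 1
      funext i
      by_cases h : i = a
      · subst h; simp [hl.1]
      · simp [h]
  rw [revR, key _ (List.nodup_finRange k)]
  congr 1
  funext i
  simp

/-- The polynomials: finite linear combinations of basis vectors. -/
def polynomials {k : ℕ} (n : Fin k → ℕ) : Submodule ℂ (FockTensor n) :=
  Submodule.span ℂ (Set.range e)

theorem dense_polynomials {k : ℕ} (n : Fin k → ℕ) :
    Dense (polynomials n : Set (FockTensor n)) := by
  intro f
  refine mem_closure_of_tendsto (hasSum_e f) (Filter.Eventually.of_forall fun s => ?_)
  exact Submodule.sum_mem _ fun β _ =>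
    Submodule.smul_mem _ _ (Submodule.subset_span ⟨β, rfl⟩)

/-- The formal power series `φ̃(𝐑) = ∑_β c_β 𝐑_{1,β̃₁} ⋯ 𝐑_{k,β̃_k}` of the vector
`φ = ∑_β c_β e_β`, applied to the vector `p`. The series converges in norm for every polynomial
`p` (`hasSum_series`), and it is used for polynomials only. -/
def series {k : ℕ} {n : Fin k → ℕ} (φ p : FockTensor n) : FockTensor n :=
  ∑' β : Words n, φ β • revR β p

theorem summable_series {k : ℕ} {n : Fin k → ℕ} (φ : FockTensor n) {p : FockTensor n}
    (hp : p ∈ polynomials n) : Summable fun β : Words n => φ β • revR β p := by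
  induction hp using Submodule.span_induction with
  | mem x hx =>
    obtain ⟨γ, rfl⟩ := hx
    have h := ((hasSum_e φ).mapL (shift (fun β => γ * β) (mul_right_injective γ))).summable
    simpa [shift_e, revR_e] using h
  | zero => simp
  | add x y _ _ hx hy => simpa [smul_add] using hx.add hy
  | smul a x _ hx => simpa [smul_comm a] using hx.const_smul a

theorem hasSum_series {k : ℕ} {n : Fin k → ℕ} (φ : FockTensor n) {p : FockTensor n}
    (hp : p ∈ polynomials n) : HasSum (fun β : Words n => φ β • revR β p) (series φ p) :=
  (summable_series φ hp).hasSum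

/-- `φ` is a right multiplier: `sup {‖φ̃(𝐑) p‖ : p a polynomial, ‖p‖ ≤ 1} < ∞`. -/
def IsRightMultiplier {k : ℕ} {n : Fin k → ℕ} (φ : FockTensor n) : Prop :=
  BddAbove {r : ℝ | ∃ p ∈ polynomials n, ‖p‖ ≤ 1 ∧ r = ‖series φ p‖}

theorem existsUnique_multiplierOp {k : ℕ} {n : Fin k → ℕ} (φ : FockTensor n)
    (hφ : IsRightMultiplier φ) :
    ∃! T : FockTensor n →L[ℂ] FockTensor n, ∀ p ∈ polynomials n, T p = series φ p := by
  obtain ⟨C, hC⟩ := hφ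
  let T₀ : polynomials n →ₗ[ℂ] FockTensor n :=
    { toFun := fun p => series φ p
      map_add' := fun p q => by
        have h := (hasSum_series φ p.2).add (hasSum_series φ q.2)
        refine (hasSum_series φ (p + q).2).unique ?_
        simpa [smul_add] using h
      map_smul' := fun a p => by
        have h := (hasSum_series φ p.2).const_smul a
        refine (hasSum_series φ (a • p).2).unique ?_
        simpa [smul_comm a] using h }
  have hT₀ : ∀ p : polynomials n, T₀ p = series φ p := fun p => rfl
  have hdense : DenseRange (polynomials n).subtype := by
    have := (dense_polynomials n).denseRange_val
    exact this
  have hbound : ∀ p : polynomials n, ‖T₀ p‖ ≤ C * ‖(polynomials n).subtype p‖ := by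
    intro p
    by_cases hp : p = 0
    · subst hp; simp
    have hp' : 0 < ‖p‖ := norm_pos_iff.mpr hp
    have h := hC ⟨((((‖p‖⁻¹ : ℝ) : ℂ) • p : polynomials n) : FockTensor n), Subtype.mem _, by
      rw [← Submodule.coe_norm, norm_smul, Complex.norm_real, norm_inv, norm_norm]
      exact (inv_mul_cancel₀ hp'.ne').le, rfl⟩
    rw [← hT₀, map_smul, norm_smul] at h
    simp only [Complex.norm_real, norm_inv, norm_norm] at h
    rw [inv_mul_le_iff₀ hp'] at h
    rw [mul_comm]
    exact h
  refine ⟨T₀.extendOfNorm (polynomials n).subtype, fun p hp => ?_, fun T hT => ?_⟩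
  · exact LinearMap.extendOfNorm_eq hdense ⟨C, hbound⟩ ⟨p, hp⟩
  · refine (LinearMap.extendOfNorm_unique hdense C hbound T ?_).symm
    exact LinearMap.ext fun p => hT p p.2

/-- The bounded operator `φ̃(𝐑)` of a right multiplier `φ`: the unique bounded operator which is
given on polynomials by the series. -/
def multiplierOp {k : ℕ} {n : Fin k → ℕ} (φ : FockTensor n) (hφ : IsRightMultiplier φ) :
    FockTensor n →L[ℂ] FockTensor n :=
  (existsUnique_multiplierOp φ hφ).choose

theorem multiplierOp_apply {k : ℕ} {n : Fin k → ℕ} (φ : FockTensor n)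
    (hφ : IsRightMultiplier φ) {p : FockTensor n} (hp : p ∈ polynomials n) :
    multiplierOp φ hφ p = series φ p :=
  (existsUnique_multiplierOp φ hφ).choose_spec.1 p hp

/-- The index set of a sequence of length `N ∈ {0, 1, 2, …} ∪ {∞}` (counted from `0`). -/
abbrev Idx (N : ℕ∞) : Type := {s : ℕ // (s : ℕ∞) < N}

/-- The sequence `ψ` of length `N` consists of right multipliers, the operators `ψ̃_s(𝐑)` are
isometries with pairwise orthogonal ranges, and `P_M = ∑_s ψ̃_s(𝐑) ψ̃_s(𝐑)^*` in the strong
operator topology. -/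
structure Represents {k : ℕ} {n : Fin k → ℕ} (M : ClosedSubmodule ℂ (FockTensor n)) {N : ℕ∞}
    (ψ : Idx N → FockTensor n) : Prop where
  isRightMultiplier : ∀ s, IsRightMultiplier (ψ s)
  isometry : ∀ s, Isometry (multiplierOp (ψ s) (isRightMultiplier s))
  orthogonal_ranges : ∀ s t, s ≠ t → ∀ f g : FockTensor n,
    ⟪multiplierOp (ψ s) (isRightMultiplier s) f,
      multiplierOp (ψ t) (isRightMultiplier t) g⟫_ℂ = 0
  hasSum_proj : ∀ ξ : FockTensor n,
    HasSum (fun s => multiplierOp (ψ s) (isRightMultiplier s)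
      (ContinuousLinearMap.adjoint (multiplierOp (ψ s) (isRightMultiplier s)) ξ)) (proj M ξ)

/-- The positive square root `T^{1/2}` of a positive operator `T` on a Hilbert space. -/
def sqrtOp {H : Type*} [NormedAddCommGroup H] [InnerProductSpace ℂ H] [CompleteSpace H]
    (T : H →L[ℂ] H) : H →L[ℂ] H := CFC.sqrt T

/-- The rank of an operator (the dimension of its range), in `{0, 1, 2, …} ∪ {∞}`. -/
def rank {H : Type*} [NormedAddCommGroup H] [InnerProductSpace ℂ H] (T : H →L[ℂ] H) : ℕ∞ :=
  Cardinal.toENat (LinearMap.rank (T : H →ₗ[ℂ] H))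

/-- The sequences `ψ` and `ψ'` in `M` are unitarily equivalent: they have the same length, and some
unitary operator `U` on `M` which commutes with every restriction `𝐒_{i,j}|_M` maps `ψ_s` to `ψ'_s`
for every `s`. (The existentially quantified `g` and `f` express `𝐒_{i,j} f ∈ M` and `ψ_s ∈ M`.) -/
def UnitarilyEquivalent {k : ℕ} {n : Fin k → ℕ} (M : ClosedSubmodule ℂ (FockTensor n))
    {N N' : ℕ∞} (ψ : Idx N → FockTensor n) (ψ' : Idx N' → FockTensor n) : Prop :=
  ∃ h : N = N', ∃ U : M.toSubmodule ≃ₗᵢ[ℂ] M.toSubmodule,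
    (∀ (i : Fin k) (j : Fin (n i)) (f : M.toSubmodule), ∃ g : M.toSubmodule,
      (g : FockTensor n) = S n i j f ∧ (U g : FockTensor n) = S n i j (U f)) ∧
    ∀ s : Idx N, ∃ f : M.toSubmodule,
      (f : FockTensor n) = ψ s ∧ (U f : FockTensor n) = ψ' ⟨s.1, h ▸ s.2⟩

end Polyball

end

noncomputable section

namespace Polyball

open ContinuousLinearMap

variable {k : ℕ} {n : Fin k → ℕ}

/-! ### Left translations -/

/-! Write `L β` for left translation by a tuple of words; the `S n i j` are the translations by
generators. Telescoping in each coordinate turns the defect mapping around: every bounded `Y`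
satisfies `Y p = ∑ L β Δ(Y) (L β)^* p` on polynomials (`hasSum_defectMap`). If the defect of `P_M`
is positive, the partial sums are bounded by `P_M`, so the formula extends to all vectors, and for
`f ∈ M` it gives `‖f‖² = ∑ ⟨(L β)^* f, Δ_M (L β)^* f⟩`.

For invariant `M`, comparing this identity for `f` and for its image under `S n i j` forces `Δ_M` to
vanish on that image (`defect_S_eq_zero`). Since `Δ_M` differs from `P_M` only by vectors of this
kind, it is idempotent, hence an orthogonal projection (`defect_defect`). The left translates of an
orthonormal basis of its range form an orthonormal basis of `M`: the norm identity gives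
orthogonality and the reconstruction formula totality.

A right multiplier satisfies `multiplierOp φ hφ (e β) = L β φ`, so representing `M` means that the
translates of the sequence form an orthonormal basis of `M`. Conversely, multiplier operators `T`
commute with the `S n i j`, so the defect of `T T^*` is `T Δ(id) T^*`, and `Δ(id)` is the projection
onto `e 1`. Thus `Δ_M` is the sum of the rank-one projections onto the `ψ s`, which gives positivity
and the rank; matching the two bases of translates gives uniqueness. -/

/-- The isometry `e β ↦ e (α * β)`. -/
def L (α : Words n) : FockTensor n →L[ℂ] FockTensor n :=
  shift (fun β => α * β) (mul_right_injective α)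

theorem L_e (α β : Words n) : L α (e β) = e (α * β) := shift_e _ _ _

theorem S_eq_L (i : Fin k) (j : Fin (n i)) : S n i j = L (Pi.mulSingle i (FreeMonoid.of j)) := rfl

theorem norm_L (α : Words n) (f : FockTensor n) : ‖L α f‖ = ‖f‖ :=
  LinearIsometry.norm_map _ f

theorem adjoint_L_L (α : Words n) (f : FockTensor n) : adjoint (L α) (L α f) = f := by
  refine ext_inner_right ℂ fun g => ?_
  rw [adjoint_inner_left]
  exact LinearIsometry.inner_map_map _ f g

theorem inner_e_left (β : Words n) (f : FockTensor n) : ⟪e β, f⟫_ℂ = f β := by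
  rw [e, lp.inner_single_left]
  simp

theorem ext_on_e {E : Type*} [AddCommMonoid E] [Module ℂ E] [TopologicalSpace E] [T2Space E]
    {A B : FockTensor n →L[ℂ] E} (h : ∀ β, A (e β) = B (e β)) : A = B :=
  ContinuousLinearMap.ext_on (dense_polynomials n) (by rintro _ ⟨β, rfl⟩; exact h β)

theorem L_one : L (1 : Words n) = ContinuousLinearMap.id ℂ _ :=
  ext_on_e fun β => by rw [L_e, one_mul]; rfl

theorem L_mul (α β : Words n) : L (α * β) = L α ∘L L β :=
  ext_on_e fun γ => by simp [L_e, mul_assoc]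

theorem L_mul_apply (α β : Words n) (f : FockTensor n) : L (α * β) f = L α (L β f) := by
  rw [L_mul]; rfl

theorem adjoint_L_mul_apply (α β : Words n) (f : FockTensor n) :
    adjoint (L (α * β)) f = adjoint (L β) (adjoint (L α) f) := by
  rw [L_mul, adjoint_comp]; rfl

theorem inner_e_e (β γ : Words n) : ⟪e β, e γ⟫_ℂ = if β = γ then 1 else 0 :=
  orthonormal_iff_ite.mp orthonormal_e β γ

theorem adjoint_L_e_mul (α β : Words n) : adjoint (L α) (e (α * β)) = e β := by
  rw [← L_e, adjoint_L_L]

theorem adjoint_L_e_eq_zero {α γ : Words n} (h : ¬ α ∣ γ) : adjoint (L α) (e γ) = 0 := by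
  have hz : ∀ β : Words n, ⟪e β, adjoint (L α) (e γ)⟫_ℂ = 0 := fun β => by
    rw [adjoint_inner_right, L_e, inner_e_e, if_neg]
    rintro rfl
    exact h ⟨β, rfl⟩
  ext β
  rw [← inner_e_left, hz]; rfl

/-- `adjoint (L α) (e γ)` is nonzero only for left divisors `α` of `γ`, so on basis vectors the
reconstruction sum is finite and can be rearranged freely. -/
theorem finite_divisors (γ : Words n) : {α : Words n | α ∣ γ}.Finite := by
  have h : ∀ i, {w : FreeMonoid (Fin (n i)) | ∃ u, w * u = γ i}.Finite := fun i => by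
    refine ((List.finite_toSet ((γ i).toList.inits)).preimage
      (FreeMonoid.toList.injective.injOn)).subset ?_
    rintro w ⟨u, hu⟩
    simp only [Set.mem_preimage, Set.mem_ofPred_eq, List.mem_inits]
    exact ⟨u.toList, by rw [← hu]; rfl⟩
  refine (Set.Finite.pi' h).subset ?_
  rintro α ⟨β, rfl⟩ i
  exact ⟨β i, rfl⟩

/-! ### The defect mapping -/

/-- The composition of the maps `id - Φ_i` along a list of indices. -/
def partialDefect (l : List (Fin k)) (Y : FockTensor n →L[ℂ] FockTensor n) :
    FockTensor n →L[ℂ] FockTensor n :=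
  l.foldr (fun i Z => Z - Phi n i Z) Y

theorem partialDefect_cons (a : Fin k) (l : List (Fin k)) (Y : FockTensor n →L[ℂ] FockTensor n) :
    partialDefect (a :: l) Y = partialDefect l Y - Phi n a (partialDefect l Y) := rfl

theorem Phi_apply (i : Fin k) (Y : FockTensor n →L[ℂ] FockTensor n) (f : FockTensor n) :
    Phi n i Y f = ∑ j, S n i j (Y (adjoint (S n i j) f)) := by
  simp [Phi]

/-- Telescoping over the words in the `a`-th coordinate. -/
theorem tsum_telescope {V : Type*} [NormedAddCommGroup V] [NormedSpace ℝ V] [CompleteSpace V]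
    (A : Set (Fin k)) {a : Fin k} (ha : a ∉ A) {t : Words n → V} (ht : t.support.Finite) :
    ∑' β, {β : Words n | ∀ i ∉ insert a A, β i = 1}.indicator
        (fun β => t β - ∑ j, t (β * Pi.mulSingle a (FreeMonoid.of j))) β =
      ∑' β, {β : Words n | ∀ i ∉ A, β i = 1}.indicator t β := by
  set W : Set (Words n) := {β | ∀ i ∉ insert a A, β i = 1} with hW
  let g : Words n × Fin (n a) → Words n := fun x => x.1 * Pi.mulSingle a (FreeMonoid.of x.2)
  have hg : Function.Injective g := by
    rintro ⟨β, j⟩ ⟨γ, j'⟩ h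
    have h1 : ∀ i, i ≠ a → β i = γ i := fun i hi => by
      have := congrFun h i
      simpa [g, hi] using this
    have h2 := congrFun h a
    simp only [g, Pi.mul_apply, Pi.mulSingle_eq_same] at h2
    have h3 : (β a).toList ++ [j] = (γ a).toList ++ [j'] := congrArg FreeMonoid.toList h2
    obtain ⟨h4, h5⟩ := List.append_inj' h3 rfl
    refine Prod.ext (funext fun i => ?_) (by simpa using h5)
    by_cases hi : i = a
    · subst hi; exact FreeMonoid.toList.injective h4
    · exact h1 i hi
  have hgW : ∀ β j, g (β, j) ∈ W ↔ β ∈ W := fun β j => by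
    simp only [hW, Set.mem_ofPred_eq, g]
    refine forall₂_congr fun i hi => ?_
    have : i ≠ a := fun h => hi (by simp [h])
    simp [this]
  have hrange : ∀ β : Words n, β ∉ Set.range g → β a = 1 := fun β hβ => by
    by_contra h
    apply hβ
    obtain ⟨l, j, hl⟩ : ∃ l j, (β a).toList = l ++ [j] := by
      rcases List.eq_nil_or_concat (β a).toList with h0 | ⟨l, j, hl⟩
      · exact absurd (FreeMonoid.toList.injective h0) h
      · exact ⟨l, j, by simpa using hl⟩
    refine ⟨(Function.update β a (FreeMonoid.ofList l), j), funext fun i => ?_⟩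
    by_cases hi : i = a
    · subst hi
      simp only [g, Pi.mul_apply, Function.update_self, Pi.mulSingle_eq_same]
      exact FreeMonoid.toList.injective hl.symm
    · simp [g, hi]
  have hrange' : ∀ β : Words n, β ∈ Set.range g → β a ≠ 1 := by
    rintro _ ⟨⟨β, j⟩, rfl⟩ h
    have h2 := congrArg FreeMonoid.toList h
    simp [g] at h2
  -- The range of `g` is exactly the set of words with nontrivial `a`-th coordinate, so `u` is the
  -- part of `t` on `W` that the subtracted terms cancel.
  set u : Words n → V := (W ∩ Set.range g).indicator t with hu
  have hsu : Summable u := summable_of_hasFiniteSupport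
    (ht.subset (by rw [Set.support_indicator]; exact Set.inter_subset_right))
  have hst : Summable (W.indicator t) := summable_of_hasFiniteSupport
    (ht.subset (by rw [Set.support_indicator]; exact Set.inter_subset_right))
  have hug : Summable fun x => u (g x) := hsu.comp_injective hg
  have e1 : ∑' x, u (g x) = ∑' β, u β := hg.tsum_eq fun β hβ => by
    by_contra h
    exact hβ (Set.indicator_of_notMem (fun h' => h h'.2) _)
  have e2 : ∑' β, ∑ j, u (g (β, j)) = ∑' β, u β := by
    rw [← e1, hug.tsum_prod]
    exact tsum_congr fun β => (tsum_fintype _).symm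
  have hs2 : Summable fun β => ∑ j, u (g (β, j)) := by
    have := hug.prod
    simpa [tsum_fintype] using this
  have e3 : ∀ β, W.indicator (fun β => t β - ∑ j, t (β * Pi.mulSingle a (FreeMonoid.of j))) β =
      W.indicator t β - ∑ j, u (g (β, j)) := fun β => by
    by_cases hβ : β ∈ W
    · rw [Set.indicator_of_mem hβ, Set.indicator_of_mem hβ]
      congr 1
      refine Finset.sum_congr rfl fun j _ => ?_
      have hm : g (β, j) ∈ W ∩ Set.range g := ⟨(hgW β j).2 hβ, ⟨_, rfl⟩⟩
      rw [hu, Set.indicator_of_mem hm]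
    · rw [Set.indicator_of_notMem hβ, Set.indicator_of_notMem hβ, Finset.sum_eq_zero, sub_zero]
      intro j _
      exact Set.indicator_of_notMem (fun h => hβ ((hgW β j).1 h.1)) _
  rw [tsum_congr e3, hst.tsum_sub hs2, e2, ← hst.tsum_sub hsu]
  refine tsum_congr fun β => ?_
  have hmem : (β ∈ {β : Words n | ∀ i ∉ A, β i = 1}) ↔ β ∈ W ∧ β a = 1 := by
    simp only [hW, Set.mem_ofPred_eq, Set.mem_insert_iff, not_or]
    refine ⟨fun h => ⟨fun i hi => h i hi.2, h a ha⟩, fun h i hi => ?_⟩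
    by_cases hia : i = a
    · subst hia; exact h.2
    · exact h.1 i ⟨hia, hi⟩
  by_cases h1 : β ∈ W
  · by_cases h2 : β ∈ Set.range g
    · rw [Set.indicator_of_mem h1, hu, Set.indicator_of_mem (Set.mem_inter h1 h2),
        Set.indicator_of_notMem, sub_self]
      exact fun h => hrange' β h2 (hmem.1 h).2
    · rw [Set.indicator_of_mem h1, hu, Set.indicator_of_notMem (fun h => h2 h.2),
        Set.indicator_of_mem (hmem.2 ⟨h1, hrange β h2⟩), sub_zero]
  · rw [Set.indicator_of_notMem h1, hu, Set.indicator_of_notMem (fun h => h1 h.1),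
      Set.indicator_of_notMem (fun h => h1 (hmem.1 h).1), sub_zero]

theorem finite_support_conj_L (Y : FockTensor n →L[ℂ] FockTensor n) (γ : Words n) :
    (Function.support fun β => L β (Y (adjoint (L β) (e γ)))).Finite := by
  refine (finite_divisors γ).subset fun β hβ => ?_
  by_contra h
  apply hβ
  simp only
  rw [adjoint_L_e_eq_zero h, map_zero, map_zero]

/-- With `Z = partialDefect l Y`, the term for `Z - Phi n a Z` at `β` is the `Z`-term at `β` minus
the `Z`-terms at `β g_j`. Hence `tsum_telescope` removes one coordinate per step, until only `β = 1`
remains. -/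
theorem tsum_partialDefect (Y : FockTensor n →L[ℂ] FockTensor n) (γ : Words n)
    (l : List (Fin k)) (hl : l.Nodup) :
    ∑' β, {β : Words n | ∀ i ∉ {i | i ∈ l}, β i = 1}.indicator
      (fun β => L β (partialDefect l Y (adjoint (L β) (e γ)))) β = Y (e γ) := by
  induction l with
  | nil =>
    rw [tsum_eq_single 1]
    · rw [Set.indicator_of_mem (by simp), L_one]
      simp [partialDefect, adjoint_id]
    · intro β hβ
      refine Set.indicator_of_notMem (fun h => hβ (funext fun i => ?_)) _
      rw [Set.mem_ofPred_eq] at h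
      exact h i (by simp)
  | cons a l ih =>
    rw [List.nodup_cons] at hl
    rw [← ih hl.2, ← tsum_telescope {i | i ∈ l} hl.1 (finite_support_conj_L _ γ)]
    have : {i | i ∈ a :: l} = insert a {i | i ∈ l} := by ext; simp
    rw [this]
    congr 1
    funext β
    congr 1
    funext β
    rw [partialDefect_cons, sub_apply, map_sub, Phi_apply, map_sum]
    congr 1
    refine Finset.sum_congr rfl fun j _ => ?_
    rw [adjoint_L_mul_apply, L_mul_apply, ← S_eq_L]

theorem hasSum_defectMap_e (Y : FockTensor n →L[ℂ] FockTensor n) (γ : Words n) :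
    HasSum (fun β => L β (defectMap n Y (adjoint (L β) (e γ)))) (Y (e γ)) := by
  have h := tsum_partialDefect Y γ _ (List.nodup_finRange k)
  have : {β : Words n | ∀ i ∉ {i | i ∈ List.finRange k}, β i = 1} = Set.univ := by
    ext; simp
  rw [this, Set.indicator_univ] at h
  rw [← h]
  exact (summable_of_hasFiniteSupport (finite_support_conj_L _ γ)).hasSum

/-- Every operator is recovered from its defect on polynomials. -/
theorem hasSum_defectMap (Y : FockTensor n →L[ℂ] FockTensor n) {p : FockTensor n}
    (hp : p ∈ polynomials n) :
    HasSum (fun β => L β (defectMap n Y (adjoint (L β) p))) (Y p) := by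
  induction hp using Submodule.span_induction with
  | mem x hx => obtain ⟨γ, rfl⟩ := hx; exact hasSum_defectMap_e Y γ
  | zero => simp [hasSum_zero]
  | add x y _ _ hx hy => simpa using hx.add hy
  | smul a x _ hx => simpa using hx.const_smul a

/-! ### Strong convergence and positive operators -/

theorem hasSum_apply_of_dense {ι E : Type*} [NormedAddCommGroup E] [NormedSpace ℂ E]
    {A : ι → E →L[ℂ] E} {T : E →L[ℂ] E} {C : ℝ} (hC : ∀ B : Finset ι, ‖∑ i ∈ B, A i‖ ≤ C)
    {s : Set E} (hs : Dense s) (h : ∀ p ∈ s, HasSum (fun i => A i p) (T p)) (f : E) :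
    HasSum (fun i => A i f) (T f) := by
  rw [HasSum, Metric.tendsto_nhds]
  intro ε hε
  have hC0 : 0 ≤ C := (norm_nonneg _).trans (hC ∅)
  -- The three summands of `δ`'s factor pay for the partial sum at `f - p`, the error at `p`, and `T
  -- (f - p)`.
  obtain ⟨δ, hδ, hδε⟩ : ∃ δ > 0, (C + 1 + ‖T‖) * δ < ε :=
    ⟨ε / (2 * (C + 1 + ‖T‖)), by positivity, by field_simp; norm_num⟩
  obtain ⟨p, hp, hfp⟩ := hs.exists_dist_lt f hδ
  filter_upwards [Metric.tendsto_nhds.1 (h p hp) δ hδ] with B h1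
  rw [dist_eq_norm] at hfp h1 ⊢
  have h2 : ∑ i ∈ B, A i f - T f =
      (∑ i ∈ B, A i) (f - p) + (∑ i ∈ B, A i p - T p) - T (f - p) := by
    simp only [map_sub, sum_apply]; abel
  rw [h2]
  calc _ ≤ ‖(∑ i ∈ B, A i) (f - p)‖ + ‖∑ i ∈ B, A i p - T p‖ + ‖T (f - p)‖ :=
        (norm_sub_le _ _).trans (by gcongr; exact norm_add_le _ _)
    _ ≤ C * δ + δ + ‖T‖ * δ := by
        gcongr
        · exact (le_of_opNorm_le _ (hC B) _).trans (by gcongr)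
        · exact (le_opNorm _ _).trans (by gcongr)
    _ < ε := by linarith

theorem eq_zero_of_re_inner_eq_zero {H : Type*} [NormedAddCommGroup H] [InnerProductSpace ℂ H]
    [CompleteSpace H] {T : H →L[ℂ] H} (hT : T.IsPositive) {x : H} (hx : (⟪x, T x⟫_ℂ).re = 0) : T x = 0 := by
  have h0 : 0 ≤ T := (nonneg_iff_isPositive T).2 hT
  have h1 : CFC.sqrt T * CFC.sqrt T = T := CFC.sqrt_mul_sqrt_self T h0
  have h2 : (CFC.sqrt T).IsPositive := (nonneg_iff_isPositive _).1 (CFC.sqrt_nonneg T)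
  have h3 : CFC.sqrt T x = 0 := by
    rw [← h1, mul_apply_eq_comp, ← h2.inner_left_eq_inner_right] at hx
    exact inner_self_eq_zero.1 (Complex.ext hx (inner_self_im (𝕜 := ℂ) _))
  rw [← h1, mul_apply_eq_comp, h3, map_zero]

/-- Applied to `Δ_M`, which turns out to be a projection, this replaces the rank of the square root
by the rank of `Δ_M`. -/
theorem sqrtOp_eq_self {H : Type*} [NormedAddCommGroup H] [InnerProductSpace ℂ H]
    [CompleteSpace H] {T : H →L[ℂ] H} (hT : T.IsPositive) (h : ∀ x, T (T x) = T x) :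
    sqrtOp T = T := by
  have h1 : T * T = T := ContinuousLinearMap.ext h
  have h2 := CFC.sqrt_mul_self T ((nonneg_iff_isPositive T).2 hT)
  rwa [h1] at h2

/-! ### The projection onto a closed subspace -/

theorem proj_mem (M : ClosedSubmodule ℂ (FockTensor n)) (f : FockTensor n) : proj M f ∈ M := by
  have : CompleteSpace M.toSubmodule := M.isClosed.completeSpace_coe
  exact M.toSubmodule.starProjection_apply_mem f

theorem proj_eq_self {M : ClosedSubmodule ℂ (FockTensor n)} {f : FockTensor n} (hf : f ∈ M) :
    proj M f = f := by
  have : CompleteSpace M.toSubmodule := M.isClosed.completeSpace_coe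
  exact Submodule.starProjection_eq_self_iff.2 hf

theorem isSelfAdjoint_proj (M : ClosedSubmodule ℂ (FockTensor n)) : IsSelfAdjoint (proj M) := by
  have : CompleteSpace M.toSubmodule := M.isClosed.completeSpace_coe
  exact isSelfAdjoint_starProjection _

theorem inner_proj_left (M : ClosedSubmodule ℂ (FockTensor n)) (f g : FockTensor n) :
    ⟪proj M f, g⟫_ℂ = ⟪f, proj M g⟫_ℂ :=
  (isSelfAdjoint_proj M).isSymmetric f g

theorem norm_proj_le (M : ClosedSubmodule ℂ (FockTensor n)) : ‖proj M‖ ≤ 1 := by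
  have : CompleteSpace M.toSubmodule := M.isClosed.completeSpace_coe
  exact M.toSubmodule.starProjection_norm_le

/-! ### Positive defect -/

section PositiveDefect

variable {M : ClosedSubmodule ℂ (FockTensor n)}

/-- On a polynomial, the nonnegative numbers `⟨p, L β Δ_M (L β)^* p⟩` add up to `⟨p, P_M p⟩`, so
finite partial sums stay below it; continuity of the quadratic form covers the rest. -/
theorem sum_conj_L_le_proj (hD : (defect M).IsPositive) (B : Finset (Words n)) :
    ∑ β ∈ B, L β ∘L defect M ∘L adjoint (L β) ≤ proj M := by
  have hpos : (∑ β ∈ B, L β ∘L defect M ∘L adjoint (L β)).IsPositive :=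
    isPositive_sum _ fun β _ => hD.conj_adjoint (L β)
  rw [ContinuousLinearMap.le_def, isPositive_def']
  refine ⟨(isSelfAdjoint_proj M).sub hpos.isSelfAdjoint, fun x => ?_⟩
  have hcl : IsClosed {x | 0 ≤ (proj M - ∑ β ∈ B, L β ∘L defect M ∘L adjoint (L β)).reApplyInnerSelf
      x} := isClosed_le continuous_const (reApplyInnerSelf_continuous _)
  refine closure_minimal (fun p hp => ?_) hcl (dense_polynomials n x)
  have h1 := (((hasSum_defectMap (proj M) hp).mapL (innerSL ℂ p))).mapL Complex.reCLM
  have h2 := sum_le_hasSum B (fun β _ => by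
    simp only [innerSL_apply_apply, Complex.reCLM_apply]
    rw [← adjoint_inner_left]
    exact hD.re_inner_nonneg_right _) h1
  simp only [innerSL_apply_apply, Complex.reCLM_apply] at h2
  rw [Set.mem_ofPred_eq, reApplyInnerSelf_apply, sub_apply, inner_sub_left, map_sub, sub_nonneg,
    sum_apply, sum_inner, map_sum, inner_re_symm]
  refine le_trans (le_of_eq (Finset.sum_congr rfl fun β _ => ?_)) h2
  rw [inner_re_symm]
  rfl

theorem hasSum_defect (hD : (defect M).IsPositive) (f : FockTensor n) :
    HasSum (fun β => L β (defect M (adjoint (L β) f))) (proj M f) := by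
  refine hasSum_apply_of_dense (A := fun β => L β ∘L defect M ∘L adjoint (L β)) (C := 1)
    (fun B => ?_) (dense_polynomials n) (fun p hp => hasSum_defectMap (proj M) hp) f
  refine (CStarAlgebra.norm_le_norm_of_nonneg_of_le ?_ (sum_conj_L_le_proj hD B)).trans
    (norm_proj_le M)
  rw [nonneg_iff_isPositive]
  exact isPositive_sum _ fun β _ => hD.conj_adjoint (L β)

theorem hasSum_re_inner_defect (hD : (defect M).IsPositive) {f : FockTensor n} (hf : f ∈ M) :
    HasSum (fun β => (⟪adjoint (L β) f, defect M (adjoint (L β) f)⟫_ℂ).re) (‖f‖ ^ 2) := by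
  have h := ((hasSum_defect hD f).mapL (innerSL ℂ f)).mapL Complex.reCLM
  simp only [innerSL_apply_apply, Complex.reCLM_apply, proj_eq_self hf] at h
  have h2 : (⟪f, f⟫_ℂ).re = ‖f‖ ^ 2 := by
    rw [inner_self_eq_norm_sq_to_K]; norm_cast
  rw [h2] at h
  convert h using 2 with β
  rw [adjoint_inner_left]

/-- The norm series of `L g f` at the indices `g * β` repeats the series of `f`, and both have the
same sum because `L g` is isometric. Nothing is left for the index `1`, whose term is the quadratic
form of `Δ_M` at `L g f`. -/
theorem defect_S_eq_zero (hM : IsInvariant M) (hD : (defect M).IsPositive) (i : Fin k)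
    (j : Fin (n i)) {f : FockTensor n} (hf : f ∈ M) : defect M (S n i j f) = 0 := by
  refine eq_zero_of_re_inner_eq_zero hD ?_
  have hx := hasSum_re_inner_defect hD (hM i j f hf)
  have hy := hasSum_re_inner_defect hD hf
  rw [S_eq_L] at hx ⊢
  set g : Words n := Pi.mulSingle i (FreeMonoid.of j) with hg
  rw [norm_L] at hx
  set q : Words n → ℝ := fun β => (⟪adjoint (L β) (L g f), defect M (adjoint (L β) (L g f))⟫_ℂ).re
  have hq : ∀ β, 0 ≤ q β := fun β => hD.re_inner_nonneg_right _
  have h1 : q 1 = (⟪L g f, defect M (L g f)⟫_ℂ).re := by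
    have : adjoint (L (1 : Words n)) = ContinuousLinearMap.id ℂ _ := by
      rw [L_one]; exact adjoint_id
    simp only [q, this]; rfl
  have h2 : ∀ β, q (g * β) = (⟪adjoint (L β) f, defect M (adjoint (L β) f)⟫_ℂ).re := fun β => by
    simp only [q, adjoint_L_mul_apply, adjoint_L_L]
  rw [← h1]
  refine le_antisymm ?_ (hq 1)
  -- A partial sum for `f`, shifted by `g` and enlarged by the index `1`, is a partial sum for `L g
  -- f`; the index `1` is new because it is not divisible by `g`.
  have h3 : ‖f‖ ^ 2 ≤ ‖f‖ ^ 2 - q 1 := by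
    refine hasSum_le_of_sum_le hy fun B => ?_
    have hnot : (1 : Words n) ∉ B.map ⟨fun β => g * β, mul_right_injective g⟩ := by
      simp only [Finset.mem_map, Function.Embedding.coeFn_mk, not_exists, not_and]
      intro β _ h
      have h' := congrArg FreeMonoid.toList (congrFun h i)
      simp [hg] at h'
    have h4 := sum_le_hasSum (insert 1 (B.map ⟨fun β => g * β, mul_right_injective g⟩))
      (fun β _ => hq β) hx
    rw [Finset.sum_insert hnot, Finset.sum_map] at h4
    simp only [Function.Embedding.coeFn_mk, h2] at h4
    linarith
  linarith

theorem partialDefect_mem (hM : IsInvariant M) (l : List (Fin k)) (f : FockTensor n) :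
    partialDefect l (proj M) f ∈ M := by
  induction l generalizing f with
  | nil => exact proj_mem M f
  | cons a l ih =>
    rw [partialDefect_cons, sub_apply, Phi_apply]
    exact M.toSubmodule.sub_mem (ih f) (M.toSubmodule.sum_mem fun j _ => hM a j _ (ih _))

theorem defect_mem (hM : IsInvariant M) (f : FockTensor n) : defect M f ∈ M :=
  partialDefect_mem hM _ f

theorem defect_proj (hM : IsInvariant M) (hD : (defect M).IsPositive) (f : FockTensor n) :
    defect M (proj M f) = defect M f := by
  refine ext_inner_right ℂ fun g => ?_
  rw [hD.inner_left_eq_inner_right, inner_proj_left, proj_eq_self (defect_mem hM g),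
    hD.inner_left_eq_inner_right]

/-- A positive defect operator of an invariant subspace is an orthogonal projection. -/
theorem defect_defect (hM : IsInvariant M) (hD : (defect M).IsPositive) (f : FockTensor n) :
    defect M (defect M f) = defect M f := by
  -- Each further factor `id - Φ_a` changes the vector only by elements of the subspaces `S n a j
  -- M`, which `Δ_M` annihilates.
  have h : ∀ l, defect M (partialDefect l (proj M) f) = defect M f := by
    intro l
    induction l with
    | nil => exact defect_proj hM hD f
    | cons a l ih =>
      rw [partialDefect_cons, sub_apply, Phi_apply, map_sub, ih, map_sum, Finset.sum_eq_zero,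
        sub_zero]
      exact fun j _ => defect_S_eq_zero hM hD a j (partialDefect_mem hM l _)
  exact h _

end PositiveDefect

/-! ### Right multipliers -/

/-- `revR β'` appends `β'` on the right, so the series at `e β` is `∑ φ β' • e (β * β')`. -/
theorem series_e (φ : FockTensor n) (β : Words n) : series φ (e β) = L β φ := by
  have h := hasSum_series φ (p := e β) (Submodule.subset_span ⟨β, rfl⟩)
  refine h.unique ?_
  simpa [L_e, revR_e] using (hasSum_e φ).mapL (L β)

theorem multiplierOp_e {φ : FockTensor n} (hφ : IsRightMultiplier φ) (β : Words n) :
    multiplierOp φ hφ (e β) = L β φ := by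
  rw [multiplierOp_apply φ hφ (Submodule.subset_span ⟨β, rfl⟩), series_e]

theorem multiplierOp_L {φ : FockTensor n} (hφ : IsRightMultiplier φ) (α : Words n)
    (f : FockTensor n) : multiplierOp φ hφ (L α f) = L α (multiplierOp φ hφ f) := by
  have : multiplierOp φ hφ ∘L L α = L α ∘L multiplierOp φ hφ :=
    ext_on_e fun β => by simp [L_e, multiplierOp_e, L_mul_apply]
  exact congrArg (fun A => A f) this

theorem apply_eq_series {φ : FockTensor n} {T : FockTensor n →L[ℂ] FockTensor n}
    (hT : ∀ β, T (e β) = L β φ) {p : FockTensor n} (hp : p ∈ polynomials n) :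
    T p = series φ p := by
  refine HasSum.unique ?_ (hasSum_series φ hp)
  induction hp using Submodule.span_induction with
  | mem x hx =>
    obtain ⟨γ, rfl⟩ := hx
    rw [hT, ← series_e]
    exact hasSum_series φ (Submodule.subset_span ⟨γ, rfl⟩)
  | zero => simp [hasSum_zero]
  | add x y _ _ hx hy => simpa [smul_add] using hx.add hy
  | smul a x _ hx => simpa [smul_comm a] using hx.const_smul a

theorem isRightMultiplier_of_apply_e {φ : FockTensor n} {T : FockTensor n →L[ℂ] FockTensor n}
    (hT : ∀ β, T (e β) = L β φ) : IsRightMultiplier φ := by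
  refine ⟨‖T‖, ?_⟩
  rintro _ ⟨p, hp, hp1, rfl⟩
  rw [← apply_eq_series hT hp]
  exact T.le_of_opNorm_le_of_le le_rfl hp1 |>.trans (by simp)

theorem multiplierOp_eq {φ : FockTensor n} {T : FockTensor n →L[ℂ] FockTensor n}
    (hT : ∀ β, T (e β) = L β φ) (hφ : IsRightMultiplier φ) : multiplierOp φ hφ = T :=
  ext_on_e fun β => by rw [multiplierOp_e, hT]

theorem adjoint_multiplierOp_coord {φ : FockTensor n} (hφ : IsRightMultiplier φ) (β : Words n)
    (ξ : FockTensor n) : adjoint (multiplierOp φ hφ) ξ β = ⟪L β φ, ξ⟫_ℂ := by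
  rw [← inner_e_left, adjoint_inner_right, multiplierOp_e]

/-! ### Representing sequences and orthonormal bases of translates -/

/-- The family of all left translates of a sequence of vectors. -/
def translates {N : ℕ∞} (ψ : Idx N → FockTensor n) (x : Idx N × Words n) : FockTensor n :=
  L x.2 (ψ x.1)

section Represents

variable {M : ClosedSubmodule ℂ (FockTensor n)} {N : ℕ∞} {ψ : Idx N → FockTensor n}

theorem Represents.adjoint_multiplierOp (h : Represents M ψ) (s : Idx N) (f : FockTensor n) :
    adjoint (multiplierOp (ψ s) (h.isRightMultiplier s))
      (multiplierOp (ψ s) (h.isRightMultiplier s) f) = f := by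
  have h1 := (AddMonoidHomClass.isometry_iff_norm _).1 (h.isometry s)
  have h2 := (ContinuousLinearMap.norm_map_iff_adjoint_comp_self _).1 h1
  exact congrArg (fun A => A f) h2

theorem Represents.orthonormal (h : Represents M ψ) : Orthonormal ℂ (translates ψ) := by
  rw [orthonormal_iff_ite]
  rintro ⟨s, β⟩ ⟨t, γ⟩
  simp only [translates]
  rw [← multiplierOp_e (h.isRightMultiplier s), ← multiplierOp_e (h.isRightMultiplier t)]
  by_cases hst : s = t
  · subst hst
    rw [← adjoint_inner_right, h.adjoint_multiplierOp, inner_e_e]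
    simp
  · rw [h.orthogonal_ranges s t hst, if_neg]
    simp [hst]

/-- By orthogonality of the ranges only the `t`-th term of `P_M` survives on the range of the `t`-th
isometry, and it acts there as the identity. -/
theorem Represents.multiplierOp_mem (h : Represents M ψ) (t : Idx N) (f : FockTensor n) :
    multiplierOp (ψ t) (h.isRightMultiplier t) f ∈ M := by
  have h1 := h.hasSum_proj (multiplierOp (ψ t) (h.isRightMultiplier t) f)
  have h2 := hasSum_single (f := fun s => multiplierOp (ψ s) (h.isRightMultiplier s)
      (adjoint (multiplierOp (ψ s) (h.isRightMultiplier s))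
        (multiplierOp (ψ t) (h.isRightMultiplier t) f))) t fun s hst => by
    rw [show adjoint (multiplierOp (ψ s) (h.isRightMultiplier s))
        (multiplierOp (ψ t) (h.isRightMultiplier t) f) = 0 from ?_, map_zero]
    refine ext_inner_left ℂ fun g => ?_
    rw [adjoint_inner_right, h.orthogonal_ranges s t hst, inner_zero_right]
  rw [h.adjoint_multiplierOp] at h2
  rw [← h1.unique h2]
  exact proj_mem M _

theorem Represents.translates_mem (h : Represents M ψ) (x : Idx N × Words n) :
    translates ψ x ∈ M := by
  rw [translates, ← multiplierOp_e (h.isRightMultiplier x.1)]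
  exact h.multiplierOp_mem _ _

theorem Represents.eq_zero (h : Represents M ψ) {f : FockTensor n} (hf : f ∈ M)
    (h0 : ∀ x, ⟪translates ψ x, f⟫_ℂ = 0) : f = 0 := by
  have h1 := h.hasSum_proj f
  rw [proj_eq_self hf] at h1
  have h2 : ∀ s, adjoint (multiplierOp (ψ s) (h.isRightMultiplier s)) f = 0 := fun s => by
    ext β
    rw [adjoint_multiplierOp_coord]
    exact h0 (s, β)
  simp only [h2, map_zero] at h1
  exact h1.unique hasSum_zero

/-- The Hilbert basis of `M` formed by the left translates of a sequence. -/
def translatesBasis (hv : Orthonormal ℂ (translates ψ)) (hmem : ∀ x, translates ψ x ∈ M)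
    (htot : ∀ f ∈ M, (∀ x, ⟪translates ψ x, f⟫_ℂ = 0) → f = 0) :
    HilbertBasis (Idx N × Words n) ℂ M.toSubmodule :=
  haveI : CompleteSpace M.toSubmodule := M.isClosed.completeSpace_coe
  HilbertBasis.mkOfOrthogonalEqBot (v := fun x => (⟨translates ψ x, hmem x⟩ : M.toSubmodule))
    (by
      rw [orthonormal_iff_ite] at hv ⊢
      exact hv)
    (by
      refine (Submodule.eq_bot_iff _).2 fun f hf => Subtype.ext (htot f f.2 fun x => ?_)
      exact (Submodule.mem_orthogonal _ _).1 hf _ (Submodule.subset_span ⟨x, rfl⟩))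

theorem coe_translatesBasis (hv : Orthonormal ℂ (translates ψ)) (hmem : ∀ x, translates ψ x ∈ M)
    (htot : ∀ f ∈ M, (∀ x, ⟪translates ψ x, f⟫_ℂ = 0) → f = 0) (x : Idx N × Words n) :
    (translatesBasis hv hmem htot x : FockTensor n) = translates ψ x := by
  have : CompleteSpace M.toSubmodule := M.isClosed.completeSpace_coe
  rw [translatesBasis, HilbertBasis.coe_mkOfOrthogonalEqBot]

theorem represents_of_orthonormal (hv : Orthonormal ℂ (translates ψ))
    (hmem : ∀ x, translates ψ x ∈ M)
    (htot : ∀ f ∈ M, (∀ x, ⟪translates ψ x, f⟫_ℂ = 0) → f = 0) : Represents M ψ := by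
  have hv' : ∀ s, Orthonormal ℂ fun β => L β (ψ s) := fun s =>
    hv.comp (fun β => (s, β)) (Prod.mk_right_injective s)
  let V : ∀ s, FockTensor n →ₗᵢ[ℂ] FockTensor n := fun s =>
    (hv' s).orthogonalFamily.linearIsometry
  have hV : ∀ s β, (V s).toContinuousLinearMap (e β) = L β (ψ s) := fun s β =>
    ((hv' s).orthogonalFamily.linearIsometry_apply_single (i := β) (1 : ℂ)).trans (by simp)
  have hmul : ∀ s, IsRightMultiplier (ψ s) := fun s => isRightMultiplier_of_apply_e (hV s)
  refine ⟨hmul, fun s => ?_, fun s t hst f g => ?_, fun ξ => ?_⟩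
  · rw [multiplierOp_eq (hV s)]
    exact (V s).isometry
  · have h0 : adjoint (multiplierOp (ψ s) (hmul s)) ∘L multiplierOp (ψ t) (hmul t) = 0 := by
      refine ext_on_e fun γ => ?_
      ext β
      rw [comp_apply, adjoint_multiplierOp_coord, multiplierOp_e]
      exact hv.2 (i := (s, β)) (j := (t, γ)) (by simp [hst])
    rw [← adjoint_inner_right, show adjoint (multiplierOp (ψ s) (hmul s))
      (multiplierOp (ψ t) (hmul t) g) = 0 from congrArg (fun A => A g) h0, inner_zero_right]
  · have : CompleteSpace M.toSubmodule := M.isClosed.completeSpace_coe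
    have h1 := ((translatesBasis hv hmem htot).hasSum_orthogonalProjectionOnto ξ).mapL
      M.toSubmodule.subtypeL
    simp only [map_smul, Submodule.subtypeL_apply, coe_translatesBasis] at h1
    -- Grouping the basis expansion of `P_M ξ` by `s`, each inner sum is the expansion of `T_s T_s^*
    -- ξ`.
    refine h1.prod_fiberwise fun s => ?_
    have h2 := (hasSum_e (adjoint (multiplierOp (ψ s) (hmul s)) ξ)).mapL
      (multiplierOp (ψ s) (hmul s))
    simp only [map_smul, multiplierOp_e, adjoint_multiplierOp_coord] at h2
    exact h2

end Represents

/-! ### The defect operator of a represented subspace -/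

-- `Phi n a` of the identity is the projection onto the `e γ` with `γ a ≠ 1`, since only the first
-- letter of `γ a` can be stripped and restored. Each factor `id - Φ_a` therefore keeps only words
-- trivial in coordinate `a`.
open scoped Classical in
theorem partialDefect_id_e {l : List (Fin k)} (hl : l.Nodup) (γ : Words n) :
    partialDefect l (ContinuousLinearMap.id ℂ (FockTensor n)) (e γ) =
      if ∀ i ∈ l, γ i = 1 then e γ else 0 := by
  induction l generalizing γ with
  | nil => simp [partialDefect]
  | cons a l ih =>
    rw [List.nodup_cons] at hl
    rw [partialDefect_cons, sub_apply, Phi_apply, ih hl.2]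
    cases hγ : (γ a) using FreeMonoid.casesOn with
    | one =>
      rw [Finset.sum_eq_zero, sub_zero]
      · simp [hγ]
      · intro j _
        rw [S_eq_L, adjoint_L_e_eq_zero, map_zero, map_zero]
        rintro ⟨δ, hδ⟩
        have h := congrArg FreeMonoid.toList (congrFun hδ a)
        simp [hγ] at h
    | of_mul j₀ w =>
      set δ : Words n := Function.update γ a w with hδ
      have hγδ : γ = Pi.mulSingle a (FreeMonoid.of j₀) * δ := by
        funext i
        by_cases hi : i = a
        · subst hi; simp [hδ, hγ]
        · simp [hδ, hi]
      rw [Finset.sum_eq_single j₀]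
      · have h1 : (∀ i ∈ l, δ i = 1) ↔ ∀ i ∈ l, γ i = 1 := by
          refine forall₂_congr fun i hi => ?_
          have : i ≠ a := fun h => hl.1 (h ▸ hi)
          simp [hδ, this]
        have h2 : ¬ ∀ i ∈ a :: l, γ i = 1 := fun h => by
          have := congrArg FreeMonoid.toList (hγ.symm.trans (h a (by simp)))
          simp at this
        rw [if_neg h2, S_eq_L]
        conv_lhs => rw [hγδ]
        rw [adjoint_L_e_mul, ih hl.2, ← hγδ]
        by_cases h : ∀ i ∈ l, γ i = 1
        · rw [if_pos h, if_pos (h1.2 h), L_e, ← hγδ, sub_self]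
        · rw [if_neg h, if_neg (mt h1.1 h), map_zero, sub_self]
      · intro j _ hj
        rw [S_eq_L, adjoint_L_e_eq_zero, map_zero, map_zero]
        rintro ⟨δ', hδ'⟩
        have h := congrArg FreeMonoid.toList (congrFun hδ' a)
        simp [hγ] at h
        exact hj h.1.symm
      · simp

theorem defectMap_id (f : FockTensor n) :
    defectMap n (ContinuousLinearMap.id ℂ (FockTensor n)) f = ⟪e 1, f⟫_ℂ • e 1 := by
  have h : defectMap n (ContinuousLinearMap.id ℂ (FockTensor n)) =
      (innerSL ℂ (e 1)).smulRight (e 1) := by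
    refine ext_on_e fun γ => ?_
    refine (partialDefect_id_e (List.nodup_finRange k) γ).trans ?_
    simp only [smulRight_apply, innerSL_apply_apply, inner_e_e]
    by_cases hγ : γ = 1
    · subst hγ; simp
    · rw [if_neg (Ne.symm hγ), zero_smul, if_neg]
      exact fun h => hγ (funext fun i => h i (List.mem_finRange i))
  rw [h]
  rfl

/-- The adjoint of `T` commutes with the adjoints of the `S n i j`, so conjugation by `T` passes
through every `Phi n i`. -/
theorem partialDefect_conj {T : FockTensor n →L[ℂ] FockTensor n}
    (hT : ∀ i j f, T (S n i j f) = S n i j (T f)) (l : List (Fin k))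
    (Y : FockTensor n →L[ℂ] FockTensor n) (f : FockTensor n) :
    partialDefect l (T ∘L Y ∘L adjoint T) f = T (partialDefect l Y (adjoint T f)) := by
  have hT' : ∀ i j f, adjoint T (adjoint (S n i j) f) = adjoint (S n i j) (adjoint T f) := by
    intro i j f
    refine ext_inner_left ℂ fun g => ?_
    simp only [adjoint_inner_right, hT]
  induction l generalizing f with
  | nil => rfl
  | cons a l ih => simp only [partialDefect_cons, sub_apply, Phi_apply, ih, map_sub, map_sum, hT, hT']

theorem hasSum_partialDefect {ι : Type*} {A : ι → FockTensor n →L[ℂ] FockTensor n}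
    {Y : FockTensor n →L[ℂ] FockTensor n} (h : ∀ f, HasSum (fun s => A s f) (Y f))
    (l : List (Fin k)) (f : FockTensor n) :
    HasSum (fun s => partialDefect l (A s) f) (partialDefect l Y f) := by
  induction l generalizing f with
  | nil => exact h f
  | cons a l ih =>
    simp only [partialDefect_cons, sub_apply, Phi_apply]
    exact (ih f).sub (hasSum_sum fun j _ => (ih _).mapL (S n a j))

section Represents

variable {M : ClosedSubmodule ℂ (FockTensor n)} {N : ℕ∞} {ψ : Idx N → FockTensor n}

/-- The defect mapping uses finite sums only and may be applied termwise to `P_M = ∑ T_s T_s^*`.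
Each term becomes `T_s` times the projection onto `e 1` times `T_s^*`, and `T_s (e 1) = ψ s`. -/
theorem Represents.hasSum_defect (h : Represents M ψ) (ξ : FockTensor n) :
    HasSum (fun s => ⟪ψ s, ξ⟫_ℂ • ψ s) (defect M ξ) := by
  have h1 := hasSum_partialDefect (A := fun s => multiplierOp (ψ s) (h.isRightMultiplier s) ∘L
    ContinuousLinearMap.id ℂ _ ∘L adjoint (multiplierOp (ψ s) (h.isRightMultiplier s)))
    h.hasSum_proj (List.finRange k) ξ
  change HasSum _ (partialDefect (List.finRange k) (proj M) ξ)
  convert h1 using 2 with s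
  rw [partialDefect_conj fun i j f => by rw [S_eq_L, multiplierOp_L]]
  refine Eq.trans ?_ (congrArg _ (defectMap_id _).symm)
  rw [adjoint_inner_right, map_smul, multiplierOp_e, L_one]
  rfl

theorem Represents.isPositive_defect (h : Represents M ψ) : (defect M).IsPositive := by
  rw [isPositive_iff_complex]
  intro x
  have h1 := (h.hasSum_defect x).mapL (innerSL ℂ x)
  have h2 : ∀ s, ⟪x, ⟪ψ s, x⟫_ℂ • ψ s⟫_ℂ = ((‖⟪ψ s, x⟫_ℂ‖ ^ 2 : ℝ) : ℂ) := fun s => by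
    rw [inner_smul_right, ← inner_conj_symm x, Complex.mul_conj']
    norm_cast
  simp only [innerSL_apply_apply, h2] at h1
  have h3 : HasSum (fun s => ‖⟪ψ s, x⟫_ℂ‖ ^ 2) (⟪x, defect M x⟫_ℂ).re := h1.mapL Complex.reCLM
  have h4 : ⟪x, defect M x⟫_ℂ = (⟪x, defect M x⟫_ℂ).re := h1.unique (Complex.hasSum_ofReal.2 h3)
  rw [inner_re_symm]
  refine ⟨?_, h3.nonneg fun s => by positivity⟩
  rw [← inner_conj_symm (defect M x) x, h4, Complex.conj_ofReal]
  rfl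

theorem Represents.isInvariant (h : Represents M ψ) : IsInvariant M := by
  intro i j f hf
  have h1 := (h.hasSum_proj f).mapL (S n i j)
  rw [proj_eq_self hf] at h1
  refine M.isClosed.mem_of_tendsto h1 (Filter.Eventually.of_forall fun B => ?_)
  refine M.toSubmodule.sum_mem fun s _ => ?_
  rw [S_eq_L, ← multiplierOp_L]
  exact h.multiplierOp_mem s _

theorem Represents.orthonormal_sequence (h : Represents M ψ) : Orthonormal ℂ ψ := by
  have := h.orthonormal.comp (fun s => (s, 1)) fun s t hst => (Prod.ext_iff.1 hst).1
  convert this using 1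
  funext s
  simp [translates, L_one]

theorem Represents.defect_apply_self (h : Represents M ψ) (s : Idx N) : defect M (ψ s) = ψ s := by
  refine (h.hasSum_defect (ψ s)).unique ?_
  have := hasSum_single (f := fun t => ⟪ψ t, ψ s⟫_ℂ • ψ t) s fun t hts => by
    rw [h.orthonormal_sequence.2 hts, zero_smul]
  simpa [h.orthonormal_sequence.1 s] using this

end Represents

/-! ### Index sets of sequences -/

theorem card_idx (N : ℕ∞) : ENat.card (Idx N) = N := by
  induction N using ENat.recTopCoe with
  | top =>
    rw [ENat.card_congr (Equiv.subtypeUnivEquiv fun s => ENat.natCast_lt_top s)]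
    simp
  | coe m =>
    rw [ENat.card_congr ((Equiv.subtypeEquivRight fun s => Nat.cast_lt).trans
      Fin.equivSubtype.symm : Idx (m : ℕ∞) ≃ Fin m)]
    simp

theorem exists_equiv_idx (ι : Type*) [Countable ι] : ∃ N, Nonempty (Idx N ≃ ι) := by
  rcases finite_or_infinite ι with h | h
  · obtain ⟨m, ⟨f⟩⟩ := Finite.exists_equiv_fin ι
    exact ⟨m, ⟨(Equiv.subtypeEquivRight fun s => Nat.cast_lt).trans
      (Fin.equivSubtype.symm.trans f.symm)⟩⟩
  · obtain ⟨f⟩ := nonempty_equiv_of_countable (α := ℕ) (β := ι)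
    exact ⟨⊤, ⟨(Equiv.subtypeUnivEquiv fun s => ENat.natCast_lt_top s).trans f⟩⟩

/-- By Bessel's inequality each of the countably many coordinates is nonzero for only countably many
`v i`, and every `v i` has a nonzero coordinate. -/
theorem countable_of_orthonormal {ι : Type*} {v : ι → FockTensor n} (hv : Orthonormal ℂ v) :
    Countable ι := by
  have h1 : ∀ β : Words n, {i | v i β ≠ 0}.Countable := fun β => by
    refine (hv.inner_products_summable (x := e β)).countable_support.mono fun i hi => ?_
    rw [Function.mem_support, ← inner_conj_symm, inner_e_left]
    simpa using hi
  have h2 : (⋃ β : Words n, {i | v i β ≠ 0}) = Set.univ := by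
    refine Set.eq_univ_of_forall fun i => ?_
    by_contra h
    refine hv.ne_zero i ?_
    ext β
    by_contra hβ
    exact h (Set.mem_iUnion.2 ⟨β, hβ⟩)
  rw [← Set.countable_univ_iff, ← h2]
  exact Set.countable_iUnion h1

/-! ### Existence -/

section Existence

variable {M : ClosedSubmodule ℂ (FockTensor n)}

theorem IsInvariant.L_mem (hM : IsInvariant M) (β : Words n) {f : FockTensor n} (hf : f ∈ M) :
    L β f ∈ M := by
  let H : Submonoid (Words n) :=
    { carrier := {β | ∀ f ∈ M, L β f ∈ M}
      one_mem' := fun f hf => by rwa [L_one]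
      mul_mem' := fun {α β} hα hβ f hf => by rw [L_mul_apply]; exact hα _ (hβ f hf) }
  refine Submonoid.pi_mem_of_mulSingle_mem (H := H) β (fun i => ?_) f hf
  generalize β i = w
  induction w using FreeMonoid.inductionOn' with
  | one => rw [Pi.mulSingle_one]; exact H.one_mem
  | of_mul j w ih => rw [Pi.mulSingle_mul]; exact H.mul_mem (fun f hf => hM i j f hf) ih

theorem orthonormal_translates (hM : IsInvariant M) (hD : (defect M).IsPositive) {N : ℕ∞}
    {ψ : Idx N → FockTensor n} (hψ : Orthonormal ℂ ψ) (hψD : ∀ s, defect M (ψ s) = ψ s) :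
    Orthonormal ℂ (translates ψ) := by
  refine ⟨fun x => by rw [translates, norm_L, hψ.1], ?_⟩
  rintro ⟨t, γ⟩ ⟨s, β⟩ hne
  simp only [translates]
  by_cases hβ : γ = β
  · subst hβ
    rw [← adjoint_inner_left, adjoint_L_L]
    exact hψ.2 fun h => hne (by rw [h])
  · have hmem : L β (ψ s) ∈ M := hM.L_mem β (hψD s ▸ defect_mem hM _)
    have h1 := hasSum_re_inner_defect hD hmem
    rw [norm_L, hψ.1] at h1
    -- The norm series of the unit vector `L β (ψ s)` already has the term `1` at `β`, so its term
    -- at `γ` must vanish.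
    have h2 := sum_le_hasSum {γ, β} (fun δ _ => hD.re_inner_nonneg_right _) h1
    rw [Finset.sum_pair hβ, adjoint_L_L, hψD] at h2
    have h3 : RCLike.re ⟪ψ s, ψ s⟫_ℂ = 1 := by
      rw [inner_self_eq_norm_sq_to_K, hψ.1]; simp
    have h4 : defect M (adjoint (L γ) (L β (ψ s))) = 0 :=
      eq_zero_of_re_inner_eq_zero hD (le_antisymm (le_of_add_le_add_right (a := 1) (by linarith!)) (hD.re_inner_nonneg_right _))
    rw [← adjoint_inner_right, ← hψD t, hD.inner_left_eq_inner_right, h4, inner_zero_right]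

theorem exists_represents (hM : IsInvariant M) (hD : (defect M).IsPositive) :
    ∃ (N : ℕ∞) (ψ : Idx N → FockTensor n), Represents M ψ ∧
      ∀ s, ψ s ∈ Set.range (defect M) := by
  -- Because `Δ_M` is idempotent, its range is this fixed space, which is visibly closed.
  let E : Submodule ℂ (FockTensor n) := LinearMap.eqLocus (defect M).toLinearMap LinearMap.id
  have hE : ∀ f, f ∈ E ↔ defect M f = f := fun f => Iff.rfl
  have hEc : IsClosed (E : Set (FockTensor n)) := isClosed_eq (defect M).continuous continuous_id
  have : CompleteSpace E := hEc.completeSpace_coe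
  obtain ⟨w, b, -⟩ := exists_hilbertBasis ℂ E
  have hb : Orthonormal ℂ fun x => (b x : FockTensor n) :=
    b.orthonormal.comp_linearIsometry E.subtypeₗᵢ
  have := countable_of_orthonormal hb
  obtain ⟨N, ⟨f⟩⟩ := exists_equiv_idx w
  have hψ : Orthonormal ℂ fun s => (b (f s) : FockTensor n) := hb.comp f f.injective
  have hψD : ∀ s, defect M (b (f s)) = b (f s) := fun s => (hE _).1 (b (f s)).2
  refine ⟨N, fun s => b (f s), represents_of_orthonormal (orthonormal_translates hM hD hψ hψD)
    (fun x => hM.L_mem _ ?_) (fun g hg h0 => ?_), fun s => ⟨_, hψD s⟩⟩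
  · change (b (f x.1) : FockTensor n) ∈ M
    rw [← hψD]
    exact defect_mem hM _
  · have h1 := hasSum_defect hD g
    rw [proj_eq_self hg] at h1
    -- The vector `Δ_M (L β)^* g` lies in `E`, and its coefficients in the basis `b` are the inner
    -- products of `g` with translates.
    have h2 : ∀ β, defect M (adjoint (L β) g) = 0 := fun β => by
      have h3 := b.hasSum_repr (⟨_, (hE _).2 (defect_defect hM hD (adjoint (L β) g))⟩ : E)
      have h4 : ∀ x, b.repr ⟨_, (hE _).2 (defect_defect hM hD (adjoint (L β) g))⟩ x = 0 := by
        intro x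
        obtain ⟨s, rfl⟩ := f.surjective x
        rw [b.repr_apply_apply, Submodule.coe_inner, ← hD.inner_left_eq_inner_right, hψD,
          adjoint_inner_right]
        exact h0 (s, β)
      simp only [h4, zero_smul] at h3
      exact congrArg Subtype.val (h3.unique hasSum_zero)
    simp only [h2, map_zero] at h1
    exact h1.unique hasSum_zero

end Existence

/-! ### Rank and uniqueness -/

section Uniqueness

variable {M : ClosedSubmodule ℂ (FockTensor n)}

theorem Represents.eq_rank {N : ℕ∞} {ψ : Idx N → FockTensor n} (h : Represents M ψ) :
    N = rank (sqrtOp (defect M)) := by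
  rw [sqrtOp_eq_self h.isPositive_defect
    (defect_defect h.isInvariant h.isPositive_defect), rank, LinearMap.rank]
  have hli := h.orthonormal_sequence.linearIndependent
  have hsub : Submodule.span ℂ (Set.range ψ) ≤ (defect M).toLinearMap.range := by
    rw [Submodule.span_le]
    rintro _ ⟨s, rfl⟩
    exact ⟨ψ s, h.defect_apply_self s⟩
  have hcard : Cardinal.toENat (Module.rank ℂ (Submodule.span ℂ (Set.range ψ))) = N := by
    rw [rank_span hli, Cardinal.mk_range_eq ψ hli.injective]
    exact card_idx N
  have hle : N ≤ Cardinal.toENat (Module.rank ℂ (defect M).toLinearMap.range) := by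
    conv_lhs => rw [← hcard]
    exact OrderHomClass.mono Cardinal.toENat (Submodule.rank_mono hsub)
  -- For infinite `N` the lower bound suffices; for finite `N` the expansion of `Δ_M` is a finite
  -- sum, so the range is the span of the sequence.
  rcases eq_or_ne N ⊤ with hN | hN
  · rw [hN, top_le_iff] at hle
    rw [hN, hle]
  · have hfin : Finite (Idx N) := by
      exact not_infinite_iff_finite.1 fun _ => hN (by rw [← card_idx N, ENat.card_eq_top_of_infinite])
    have := Fintype.ofFinite (Idx N)
    have hspan : (defect M).toLinearMap.range = Submodule.span ℂ (Set.range ψ) := by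
      refine le_antisymm ?_ hsub
      rintro _ ⟨x, rfl⟩
      rw [coe_coe, (h.hasSum_defect x).unique (hasSum_fintype _)]
      exact Submodule.sum_mem _ fun s _ => Submodule.smul_mem _ _ (Submodule.subset_span ⟨s, rfl⟩)
    rw [hspan, hcard]

theorem Represents.unitarilyEquivalent {N N' : ℕ∞} {ψ : Idx N → FockTensor n}
    {ψ' : Idx N' → FockTensor n} (h : Represents M ψ) (h' : Represents M ψ') :
    UnitarilyEquivalent M ψ ψ' := by
  obtain rfl : N = N' := h.eq_rank.trans h'.eq_rank.symm
  refine ⟨rfl, ?_⟩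
  let b := translatesBasis h.orthonormal h.translates_mem fun f hf => h.eq_zero hf
  let b' := translatesBasis h'.orthonormal h'.translates_mem fun f hf => h'.eq_zero hf
  have hb : ∀ x, (b x : FockTensor n) = translates ψ x := coe_translatesBasis _ _ _
  have hb' : ∀ x, (b' x : FockTensor n) = translates ψ' x := coe_translatesBasis _ _ _
  let U := b.repr.trans b'.repr.symm
  have hU : ∀ x, U (b x) = b' x := fun x => by
    classical
    simp [U, HilbertBasis.repr_self]
  refine ⟨U, fun i j f => ?_, fun s => ⟨b (s, 1), ?_, ?_⟩⟩
  · let T : M.toSubmodule →L[ℂ] M.toSubmodule := (S n i j ∘L M.toSubmodule.subtypeL).codRestrict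
      M.toSubmodule fun f => h.isInvariant i j f f.2
    refine ⟨T f, rfl, ?_⟩
    have hcomm : M.toSubmodule.subtypeL ∘L (U : M.toSubmodule →L[ℂ] M.toSubmodule) ∘L T =
        S n i j ∘L M.toSubmodule.subtypeL ∘L (U : M.toSubmodule →L[ℂ] M.toSubmodule) := by
      refine ContinuousLinearMap.ext_on
        (Submodule.dense_iff_topologicalClosure_eq_top.2 b.dense_span) ?_
      rintro _ ⟨⟨s, β⟩, rfl⟩
      -- Both bases are permuted into themselves by `S n i j` through the same injection of indices,
      -- so the unitary matching them commutes with it.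
      have hT : T (b (s, β)) = b (s, Pi.mulSingle i (FreeMonoid.of j) * β) := by
        refine Subtype.ext ?_
        rw [hb]
        change S n i j (b (s, β) : FockTensor n) = _
        rw [hb, translates, translates, S_eq_L, L_mul_apply]
      change (U (T (b (s, β))) : FockTensor n) = S n i j (U (b (s, β)))
      rw [hT, hU, hU, hb', hb', translates, translates, S_eq_L, L_mul_apply]
    exact congrArg (fun A => A f) hcomm
  · rw [hb, translates, L_one]; rfl
  · rw [hU, hb', translates, L_one]; rfl

end Uniqueness

end Polyball

end

theorem theorem2p1 {k : ℕ} (n : Fin k → ℕ) (hn : ∀ i, 1 ≤ n i)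
    (M : ClosedSubmodule ℂ (Polyball.FockTensor n)) :
    ((Polyball.IsInvariant M ∧ (Polyball.defect M).IsPositive) ↔
      ∃ (N : ℕ∞) (ψ : Polyball.Idx N → Polyball.FockTensor n), Polyball.Represents M ψ) ∧
    (∀ (N N' : ℕ∞) (ψ : Polyball.Idx N → Polyball.FockTensor n)
      (ψ' : Polyball.Idx N' → Polyball.FockTensor n),
      Polyball.Represents M ψ → Polyball.Represents M ψ' →
        Polyball.UnitarilyEquivalent M ψ ψ') ∧
    (Polyball.IsInvariant M → (Polyball.defect M).IsPositive →
      ∃ (N : ℕ∞) (ψ : Polyball.Idx N → Polyball.FockTensor n), Polyball.Represents M ψ ∧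
        ∀ s, ψ s ∈ Set.range (Polyball.defect M)) ∧
    (∀ (N : ℕ∞) (ψ : Polyball.Idx N → Polyball.FockTensor n), Polyball.Represents M ψ →
      N = Polyball.rank (Polyball.sqrtOp (Polyball.defect M)) ∧
      ∀ ξ : Polyball.FockTensor n,
        HasSum (fun s => inner ℂ (ψ s) ξ • ψ s) (Polyball.defect M ξ)) := by
  refine ⟨⟨fun h => ?_, ?_⟩, fun N N' ψ ψ' h h' => h.unitarilyEquivalent h',
    Polyball.exists_represents, fun N ψ h => ⟨h.eq_rank, h.hasSum_defect⟩⟩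
  · obtain ⟨N, ψ, hψ, -⟩ := Polyball.exists_represents h.1 h.2
    exact ⟨N, ψ, hψ⟩
  · rintro ⟨N, ψ, h⟩
    exact ⟨h.isInvariant, h.isPositive_defect⟩
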